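/- Let $n\in\mathbb{N}$, $n\ge 1$, and $\alpha\in(0,1)$, and set $$\mu_{n,\alpha}=2^{\alpha}\pi^{-\frac n2}\,\frac{\Gamma\left(\frac{n+\alpha+1}{2}\right)}{\Gamma\left(\frac{1-\alpha}{2}\right)}.$$ For $\varphi\in C_c^\infty(\mathbb{R}^n;\mathbb{R}^n)$ let the fractional divergence of $\varphi$ be $$\operatorname{div}^\alpha\varphi(x)=\mu_{n,\alpha}\int_{\mathbb{R}^n}\frac{(y-x)\cdot(\varphi(y)-\varphi(x))}{|y-x|^{n+\alpha+1}}\,dy,\qquad x\in\mathbb{R}^n.$$ For $p\in[1,+\infty]$ and $f\in L^p(\mathbb{R}^n)$ let the total fractional variation of $f$ be $$|D^\alpha f|(\mathbb{R}^n)=\sup\left\{\int_{\mathbb{R}^n}f\,\operatorname{div}^\alpha\varphi\,dx \;:\; \varphi\in C^\infty_c(\mathbb{R}^n;\mathbb{R}^n),\ \|\varphi\|_{L^\infty(\mathbb{R}^n;\mathbb{R}^n)}\le 1\right\}\in[0,+\infty],$$ and let $BV^{\alpha,p}(\mathbb{R}^n)=\{f\in L^p(\mathbb{R}^n) : |D^\alpha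 f|(\mathbb{R}^n)<+\infty\}$. **Theorem.** Let $\alpha\in(0,1)$ and $p\in\left[1,\frac{n}{n-\alpha}\right)$. If $f\in BV^{\alpha,p}(\mathbb{R}^n)$, then there exists a sequence $(f_k)_{k\in\mathbb{N}}\subset C_c^\infty(\mathbb{R}^n)$ such that, as $k\to+\infty$, 1. $f_k\to f$ in $L^p(\mathbb{R}^n)$; 2. $|D^\alpha f_k|(\mathbb{R}^n)\to|D^\alpha f|(\mathbb{R}^n)$. -/

import Mathlib

open MeasureTheory Filter Topology
open scoped ENNReal ContDiff

namespace FractionalVariation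

/-- The renormalizing constant
`μ_{n,α} = 2^α π^{-n/2} Γ((n + α + 1) / 2) / Γ((1 - α) / 2)`. -/
noncomputable def fracConst (n : ℕ) (α : ℝ) : ℝ :=
  (2 : ℝ) ^ α * Real.pi ^ (-(n : ℝ) / 2) *
    (Real.Gamma (((n : ℝ) + α + 1) / 2) / Real.Gamma ((1 - α) / 2))

/-- The fractional divergence
`div^α φ (x) = μ_{n,α} ∫ (y - x) · (φ y - φ x) / |y - x|^{n + α + 1} dy`.
For Lipschitz `φ` with compact support and `α ∈ (0,1)` the integral converges absolutely. -/
noncomputable def fracDiv {n : ℕ} (α : ℝ)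
    (φ : EuclideanSpace ℝ (Fin n) → EuclideanSpace ℝ (Fin n))
    (x : EuclideanSpace ℝ (Fin n)) : ℝ :=
  fracConst n α *
    ∫ y : EuclideanSpace ℝ (Fin n),
      inner ℝ (y - x) (φ y - φ x) / ‖y - x‖ ^ ((n : ℝ) + α + 1)

/-- The total fractional variation `|D^α f|(ℝⁿ)`: the supremum of `∫ f div^α φ dx` over all
`φ ∈ C_c^∞(ℝⁿ; ℝⁿ)` with `|φ| ≤ 1` everywhere. It takes values in `[0, ∞]`, because `φ = 0`
competes; for the same reason truncating the negative competitors at `0` does not change it. -/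
noncomputable def fracVariation {n : ℕ} (α : ℝ) (f : EuclideanSpace ℝ (Fin n) → ℝ) : ℝ≥0∞ :=
  ⨆ (φ : EuclideanSpace ℝ (Fin n) → EuclideanSpace ℝ (Fin n))
    (_ : ContDiff ℝ ∞ φ) (_ : HasCompactSupport φ) (_ : ∀ x, ‖φ x‖ ≤ 1),
    ENNReal.ofReal (∫ x, f x * fracDiv α φ x)

/-- `f ∈ BV^{α,p}(ℝⁿ)`: `f ∈ L^p(ℝⁿ)` has finite total fractional variation. -/
def MemBV {n : ℕ} (α : ℝ) (p : ℝ≥0∞) (f : EuclideanSpace ℝ (Fin n) → ℝ) : Prop :=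
  MemLp f p volume ∧ fracVariation α f < (⊤ : ℝ≥0∞)

end FractionalVariation

/-! Cut off, then mollify. For `η` with `|η| ≤ 1` and an admissible test field `φ`, the field `ηφ`
is again admissible, and `η div^α φ - div^α(ηφ)` is bounded pointwise by a constant times the
fractional difference integral of `η` alone, uniformly in `φ` (`enorm_mul_fracDiv_sub_le`). Hence
`|D^α(ηf)| ≤ |D^α f| + C ∫ |f| G_η`, where `G_η` is `incrementGauge α η` (`fracVariation_mul_le`).

For the dilated cut-off `η_R`, scaling gives `sup G ≲ R^{-α}` and `∫ G ≲ R^{n-α}`. Hölder then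
bounds the error by `R^e ‖f‖_p` up to a constant, with `e = -α/p + (n-α)(1-1/p) = (n-α) - n/p`,
which is negative exactly when `p < n/(n-α)` (`tendsto_lintegral_incrementGauge_cutoff`).

Mollification averages translates, and the variation is translation invariant, so it costs nothing
(`fracVariation_mollify_le`). This yields smooth compactly supported approximants whose variation
exceeds that of `f` by at most `ε`. The opposite inequality in the limit is lower semicontinuity,
since pairing with a fixed `div^α φ` is continuous on `L^p` (`eventually_lt_fracVariation`). -/

namespace FractionalVariation

/-! ### Scaling and integral bounds for the fractional kernel -/

section Kernel

variable {n : ℕ} {F : Type*} [NormedAddCommGroup F]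

local notation "𝔼" => EuclideanSpace ℝ (Fin n)

/-- The mass `∫ min(|z|, 1) |z|^{-(n+α)} dz` of the truncated fractional kernel. -/
noncomputable def truncMass (n : ℕ) (α : ℝ) : ℝ≥0∞ :=
  ∫⁻ z : EuclideanSpace ℝ (Fin n), ENNReal.ofReal (min ‖z‖ 1 * ‖z‖ ^ (-((n : ℝ) + α)))

/-- The absolute fractional difference `∫ |φ(x+z) - φ(x)| |z|^{-(n+α)} dz`. -/
noncomputable def incrementGauge (α : ℝ) (φ : 𝔼 → F) (x : 𝔼) : ℝ≥0∞ :=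
  ∫⁻ z : 𝔼, ‖φ (x + z) - φ x‖ₑ * ENNReal.ofReal (‖z‖ ^ (-((n : ℝ) + α)))

/-- Increments of `φ` are at most `A * min (B * |z|) 1`. -/
def HasTruncatedModulus (φ : 𝔼 → F) (A B : ℝ) : Prop :=
  ∀ x z, ‖φ (x + z) - φ x‖ ≤ A * min (B * ‖z‖) 1

/-- In polar coordinates the radial density is `r^{-α}` on `(0,1]`, integrable since `α < 1`, and
`r^{-1-α}` beyond `1`, integrable since `α > 0`. -/
theorem truncMass_lt_top (hn : 1 ≤ n) {α : ℝ} (hα : α ∈ Set.Ioo (0 : ℝ) 1) :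
    truncMass n α < ⊤ := by
  have : Nonempty (Fin n) := ⟨⟨0, hn⟩⟩
  have h : Integrable (fun z : 𝔼 => (fun r : ℝ => min r 1 * r ^ (-((n : ℝ) + α))) ‖z‖) := by
    rw [integrable_fun_norm_addHaar volume (f := fun r : ℝ => min r 1 * r ^ (-((n : ℝ) + α)))]
    have key : ∀ r : ℝ, 0 < r → r ^ (Module.finrank ℝ 𝔼 - 1) •
        (min r 1 * r ^ (-((n : ℝ) + α))) = min r 1 * r ^ (-1 - α) := by
      intro r hr
      have h1 : r ^ (Module.finrank ℝ 𝔼 - 1) = r ^ ((n : ℝ) - 1) := by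
        rw [← Real.rpow_natCast]
        simp [Nat.cast_sub hn]
      rw [h1, smul_eq_mul, mul_left_comm, ← Real.rpow_add hr]
      congr 2
      ring
    rw [← Set.Ioc_union_Ioi_eq_Ioi (zero_le_one (α := ℝ)), integrableOn_union]
    constructor
    · have : IntegrableOn (fun r : ℝ => r ^ (-α)) (Set.Ioc 0 1) := by
        rw [← intervalIntegrable_iff_integrableOn_Ioc_of_le zero_le_one]
        exact intervalIntegral.intervalIntegrable_rpow' (by linarith [hα.2])
      refine this.congr_fun (fun r hr => ?_) measurableSet_Ioc
      dsimp only
      rw [key r hr.1, min_eq_left hr.2]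
      nth_rw 2 [← Real.rpow_one r]
      rw [← Real.rpow_add hr.1]
      congr 1
      ring
    · have : IntegrableOn (fun r : ℝ => r ^ (-1 - α)) (Set.Ioi 1) :=
        integrableOn_Ioi_rpow_of_lt (by linarith [hα.1]) one_pos
      refine this.congr_fun (fun r hr => ?_) measurableSet_Ioi
      have hr' : (1 : ℝ) < r := hr
      dsimp only
      rw [key r (by linarith), min_eq_right hr'.le, one_mul]
  exact h.lintegral_lt_top

theorem measurable_norm_rpow (α : ℝ) :
    Measurable (fun z : 𝔼 => ‖z‖ ^ (-((n : ℝ) + α))) :=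
  measurable_norm.pow_const _

theorem lintegral_comp_smul (f : 𝔼 → ℝ≥0∞) {B : ℝ} (hB : 0 < B) :
    ∫⁻ z, f (B • z) = ENNReal.ofReal (B ^ (-(n : ℝ))) * ∫⁻ z, f z := by
  have h := Measure.map_addHaar_smul (volume : Measure 𝔼) hB.ne'
  have h1 : ∫⁻ z, f (B • z) = ∫⁻ z, f z ∂(Measure.map (B • ·) (volume : Measure 𝔼)) :=
    ((Homeomorph.smulOfNeZero B hB.ne').measurableEmbedding.lintegral_map f).symm
  rw [h1, h, lintegral_smul_measure, smul_eq_mul, Real.rpow_neg hB.le, Real.rpow_natCast,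
    finrank_euclideanSpace_fin, abs_of_pos (by positivity)]

/-- Substituting `Bz` for `z`: homogeneity of the kernel gives `B^{n+α}` and the Jacobian `B^{-n}`.
With `B = R⁻¹` this is the source of the decay `R^{-α}`. -/
theorem lintegral_truncated_kernel {α : ℝ} {B : ℝ} (hB : 0 < B) :
    ∫⁻ z : 𝔼, ENNReal.ofReal (min (B * ‖z‖) 1 * ‖z‖ ^ (-((n : ℝ) + α))) =
      ENNReal.ofReal (B ^ α) * truncMass n α := by
  have h := lintegral_comp_smul (n := n)
    (fun z => ENNReal.ofReal (min ‖z‖ 1 * ‖z‖ ^ (-((n : ℝ) + α)))) hB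
  have h2 : ∀ z : 𝔼, ENNReal.ofReal (min (B * ‖z‖) 1 * ‖z‖ ^ (-((n : ℝ) + α))) =
      ENNReal.ofReal (B ^ ((n : ℝ) + α)) *
        ENNReal.ofReal (min ‖B • z‖ 1 * ‖B • z‖ ^ (-((n : ℝ) + α))) := by
    intro z
    rw [← ENNReal.ofReal_mul (by positivity), norm_smul, Real.norm_of_nonneg hB.le,
      Real.mul_rpow hB.le (norm_nonneg z), Real.rpow_neg hB.le]
    congr 1
    have : B ^ ((n : ℝ) + α) ≠ 0 := (Real.rpow_pos_of_pos hB _).ne'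
    field_simp
  simp_rw [h2]
  rw [lintegral_const_mul' _ _ ENNReal.ofReal_ne_top, h, ← mul_assoc,
    ← ENNReal.ofReal_mul (by positivity), ← Real.rpow_add hB]
  simp [truncMass]

theorem HasTruncatedModulus.enorm_mul_le {φ : 𝔼 → F} {A B : ℝ} (hA : 0 ≤ A)
    (h : HasTruncatedModulus φ A B) (α : ℝ) (x z : 𝔼) :
    ‖φ (x + z) - φ x‖ₑ * ENNReal.ofReal (‖z‖ ^ (-((n : ℝ) + α))) ≤
      ENNReal.ofReal A *
        ENNReal.ofReal (min (B * ‖z‖) 1 * ‖z‖ ^ (-((n : ℝ) + α))) := by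
  rw [← ofReal_norm, ← ENNReal.ofReal_mul (norm_nonneg _), ← ENNReal.ofReal_mul hA, ← mul_assoc]
  exact ENNReal.ofReal_le_ofReal (mul_le_mul_of_nonneg_right (h x z) (by positivity))

theorem incrementGauge_le {φ : 𝔼 → F} {A B α : ℝ} (hA : 0 ≤ A) (hB : 0 < B)
    (h : HasTruncatedModulus φ A B) (x : 𝔼) :
    incrementGauge α φ x ≤ ENNReal.ofReal A * (ENNReal.ofReal (B ^ α) * truncMass n α) := by
  rw [← lintegral_truncated_kernel hB, ← lintegral_const_mul' _ _ ENNReal.ofReal_ne_top]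
  exact lintegral_mono fun z => h.enorm_mul_le hA α x z

theorem measurable_incrementIntegrand {φ : 𝔼 → F} (hφ : Continuous φ) (α : ℝ) :
    Measurable (fun q : 𝔼 × 𝔼 => ‖φ (q.1 + q.2) - φ q.1‖ₑ *
      ENNReal.ofReal (‖q.2‖ ^ (-((n : ℝ) + α)))) := by
  have h1 : Continuous (fun q : 𝔼 × 𝔼 => ‖φ (q.1 + q.2) - φ q.1‖ₑ) := by fun_prop
  exact h1.measurable.mul ((measurable_norm_rpow α).comp measurable_snd).ennreal_ofReal

theorem measurable_incrementGauge {φ : 𝔼 → F} (hφ : Continuous φ) (α : ℝ) :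
    Measurable (incrementGauge α φ) :=
  (measurable_incrementIntegrand hφ α).lintegral_prod_right'

/-- By Tonelli, integrate in `x` first: for fixed `z` the increment vanishes unless `x` lies in `S`
or `S - z`, two sets whose measures add up to `2|S|` for every `z`. -/
theorem lintegral_incrementGauge_le {φ : 𝔼 → F} {A B α : ℝ} (hA : 0 ≤ A) (hB : 0 < B)
    (hc : Continuous φ) (h : HasTruncatedModulus φ A B) {S : Set 𝔼} (hS : MeasurableSet S)
    (hφS : ∀ x ∉ S, φ x = 0) :
    ∫⁻ x, incrementGauge α φ x ≤
      2 * volume S * (ENNReal.ofReal A * (ENNReal.ofReal (B ^ α) * truncMass n α)) := by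
  have hm := measurable_incrementIntegrand hc α
  unfold incrementGauge
  rw [lintegral_lintegral_swap hm.aemeasurable]
  rw [← lintegral_truncated_kernel hB, ← lintegral_const_mul' _ _ ENNReal.ofReal_ne_top,
    ← lintegral_const_mul]
  swap
  · refine Measurable.const_mul (Measurable.ennreal_ofReal ?_) _
    exact (Continuous.measurable (by fun_prop)).mul (measurable_norm_rpow α)
  refine lintegral_mono fun z => ?_
  set K := ENNReal.ofReal A *
    ENNReal.ofReal (min (B * ‖z‖) 1 * ‖z‖ ^ (-((n : ℝ) + α))) with hK
  calc ∫⁻ x, ‖φ (x + z) - φ x‖ₑ * ENNReal.ofReal (‖z‖ ^ (-((n : ℝ) + α)))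
      ≤ ∫⁻ x, (S.indicator 1 (x + z) + S.indicator 1 x) * K := by
        refine lintegral_mono fun x => ?_
        by_cases h1 : x ∈ S
        · refine (h.enorm_mul_le hA α x z).trans ?_
          simp only [h1, Set.indicator_of_mem, Pi.one_apply, add_mul, one_mul]
          exact le_add_self
        · by_cases h2 : x + z ∈ S
          · refine (h.enorm_mul_le hA α x z).trans ?_
            simp only [h2, Set.indicator_of_mem, Pi.one_apply, add_mul, one_mul]
            exact le_self_add
          · simp [hφS x h1, hφS _ h2]
    _ = 2 * volume S * K := by
        have hms : Measurable (S.indicator (1 : 𝔼 → ℝ≥0∞)) := measurable_one.indicator hS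
        rw [lintegral_mul_const _ (by fun_prop), lintegral_add_right _ hms,
          lintegral_add_right_eq_self (fun x => S.indicator (1 : 𝔼 → ℝ≥0∞) x) z,
          lintegral_indicator_one hS, two_mul]

/-- Hölder's inequality in the form `∫ |f| G ≤ C^{1/p} ‖f‖_p (∫ G)^{1-1/p}` for `G ≤ C`. -/
theorem lintegral_enorm_mul_le {f : 𝔼 → ℝ} (hf : AEStronglyMeasurable f) {G : 𝔼 → ℝ≥0∞}
    (hG : Measurable G) {C : ℝ≥0∞} (hC : ∀ x, G x ≤ C) {p : ℝ} (hp : 1 ≤ p) :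
    ∫⁻ x, ‖f x‖ₑ * G x ≤
      C ^ (1 / p) * eLpNorm f (ENNReal.ofReal p) volume * (∫⁻ x, G x) ^ (1 - 1 / p) := by
  have hp0 : 0 < p := by linarith
  have hac : volume.withDensity G ≪ (volume : Measure 𝔼) := withDensity_absolutelyContinuous _ _
  -- Use the measure `G dx`: its total mass is `∫ G`, which enters through the comparison of `L^1`
  -- with `L^p`, and it is dominated by `C dx`.
  have h1 : ∫⁻ x, ‖f x‖ₑ * G x = eLpNorm f 1 (volume.withDensity G) := by
    rw [eLpNorm_one_eq_lintegral_enorm, lintegral_withDensity_eq_lintegral_mul₀' hG.aemeasurable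
      (hf.mono_ac hac).enorm]
    simp [mul_comm]
  have h2 : volume.withDensity G ≤ C • (volume : Measure 𝔼) := by
    rw [← withDensity_const]
    exact withDensity_mono (Eventually.of_forall hC)
  rw [h1]
  refine (eLpNorm_le_eLpNorm_mul_rpow_measure_univ (q := ENNReal.ofReal p) (by simpa using hp)
    (hf.mono_ac hac)).trans ?_
  rw [withDensity_apply _ MeasurableSet.univ, Measure.restrict_univ, ENNReal.toReal_ofReal hp0.le]
  simp only [ENNReal.toReal_one, div_one]
  gcongr
  refine (eLpNorm_mono_measure f h2).trans ?_
  rw [eLpNorm_smul_measure_of_ne_top ENNReal.ofReal_ne_top, ENNReal.toReal_div,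
    ENNReal.toReal_ofReal hp0.le, ENNReal.toReal_one, smul_eq_mul]

end Kernel

/-! ### Fractional divergence, lower semicontinuity and the Leibniz defect -/

section Divergence

variable {n : ℕ}

local notation "𝔼" => EuclideanSpace ℝ (Fin n)

theorem fracDiv_eq (α : ℝ) (φ : 𝔼 → 𝔼) (x : 𝔼) :
    fracDiv α φ x = fracConst n α *
      ∫ z : 𝔼, inner ℝ z (φ (x + z) - φ x) / ‖z‖ ^ ((n : ℝ) + α + 1) := by
  unfold fracDiv
  rw [← integral_add_left_eq_self _ x]
  simp

/-- Cauchy–Schwarz absorbs one power of `|z|`. -/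
theorem enorm_inner_div_le (α : ℝ) (z w : 𝔼) :
    ‖inner ℝ z w / ‖z‖ ^ ((n : ℝ) + α + 1)‖ₑ ≤
      ‖w‖ₑ * ENNReal.ofReal (‖z‖ ^ (-((n : ℝ) + α))) := by
  rw [← ofReal_norm, ← ofReal_norm, ← ENNReal.ofReal_mul (norm_nonneg _)]
  refine ENNReal.ofReal_le_ofReal ?_
  rcases eq_or_ne z 0 with rfl | hz
  · simp only [inner_zero_left, zero_div, norm_zero]
    positivity
  have hz' : 0 < ‖z‖ := norm_pos_iff.2 hz
  rw [norm_div, Real.norm_of_nonneg (by positivity : 0 ≤ ‖z‖ ^ ((n : ℝ) + α + 1)),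
    div_le_iff₀ (by positivity), mul_assoc, ← Real.rpow_add hz']
  have : -((n : ℝ) + α) + (n + α + 1) = 1 := by ring
  rw [this, Real.rpow_one, mul_comm]
  exact norm_inner_le_norm z w

theorem measurable_divIntegrand {φ : 𝔼 → 𝔼} (hφ : Continuous φ) (α : ℝ) :
    Measurable (fun q : 𝔼 × 𝔼 =>
      inner ℝ q.2 (φ (q.1 + q.2) - φ q.1) / ‖q.2‖ ^ ((n : ℝ) + α + 1)) := by
  have h1 : Continuous (fun q : 𝔼 × 𝔼 => inner ℝ q.2 (φ (q.1 + q.2) - φ q.1)) := by fun_prop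
  exact h1.measurable.div ((measurable_norm.comp measurable_snd).pow_const _)

theorem measurable_fracDiv {φ : 𝔼 → 𝔼} (hφ : Continuous φ) (α : ℝ) :
    Measurable (fracDiv α φ) := by
  have h : fracDiv α φ = fun x => fracConst n α *
      ∫ z : 𝔼, inner ℝ z (φ (x + z) - φ x) / ‖z‖ ^ ((n : ℝ) + α + 1) :=
    funext (fracDiv_eq α φ)
  rw [h]
  exact ((measurable_divIntegrand hφ α).stronglyMeasurable.integral_prod_right'
    (ν := (volume : Measure 𝔼))).measurable.const_mul _

/-- The Lipschitz bound serves short increments, twice the supremum long ones. -/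
theorem exists_hasTruncatedModulus {F : Type*} [NormedAddCommGroup F] [NormedSpace ℝ F]
    {φ : 𝔼 → F} (hφ : ContDiff ℝ ∞ φ) (hc : HasCompactSupport φ) :
    ∃ A : ℝ, 0 ≤ A ∧ HasTruncatedModulus φ A 1 := by
  obtain ⟨L, hL⟩ := hφ.lipschitzWith_of_hasCompactSupport hc (by simp)
  obtain ⟨M, hM⟩ := hc.exists_bound_of_continuous hφ.continuous
  have hM0 : 0 ≤ M := (norm_nonneg _).trans (hM 0)
  refine ⟨max L (2 * M), le_max_of_le_left L.2, fun x z => ?_⟩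
  have h1 : ‖φ (x + z) - φ x‖ ≤ L * ‖z‖ := by
    simpa [dist_eq_norm] using hL.dist_le_mul (x + z) x
  have h2 : ‖φ (x + z) - φ x‖ ≤ 2 * M := by
    linarith [norm_sub_le (φ (x + z)) (φ x), hM (x + z), hM x]
  have h0 : 0 ≤ max (L : ℝ) (2 * M) := le_max_of_le_left L.2
  rw [one_mul, mul_min_of_nonneg _ _ h0]
  refine le_min (h1.trans ?_) (h2.trans ?_)
  · exact mul_le_mul_of_nonneg_right (le_max_left _ _) (norm_nonneg _)
  · rw [mul_one]
    exact le_max_right _ _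

theorem exists_incrementGauge_le (hn : 1 ≤ n) {α : ℝ} (hα : α ∈ Set.Ioo (0 : ℝ) 1)
    {F : Type*} [NormedAddCommGroup F] [NormedSpace ℝ F]
    {φ : 𝔼 → F} (hφ : ContDiff ℝ ∞ φ) (hc : HasCompactSupport φ) :
    ∃ C : ℝ≥0∞, C < ⊤ ∧ (∀ x, incrementGauge α φ x ≤ C) ∧ ∫⁻ x, incrementGauge α φ x ≤ C := by
  obtain ⟨A, hA, h⟩ := exists_hasTruncatedModulus hφ hc
  have hW := truncMass_lt_top hn hα
  have h1 := incrementGauge_le (α := α) hA one_pos h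
  have h2 := lintegral_incrementGauge_le (α := α) hA one_pos hφ.continuous h
    (isClosed_tsupport φ).measurableSet (fun x hx => image_eq_zero_of_notMem_tsupport hx)
  refine ⟨max _ _, ?_, fun x => (h1 x).trans (le_max_left _ _), h2.trans (le_max_right _ _)⟩
  have hS : volume (tsupport φ) < ⊤ := hc.measure_lt_top
  refine max_lt ?_ ?_
  · exact ENNReal.mul_lt_top ENNReal.ofReal_lt_top (ENNReal.mul_lt_top ENNReal.ofReal_lt_top hW)
  · exact ENNReal.mul_lt_top (ENNReal.mul_lt_top (by simp) hS)
      (ENNReal.mul_lt_top ENNReal.ofReal_lt_top (ENNReal.mul_lt_top ENNReal.ofReal_lt_top hW))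

theorem integrable_divIntegrand (hn : 1 ≤ n) {α : ℝ} (hα : α ∈ Set.Ioo (0 : ℝ) 1)
    {φ : 𝔼 → 𝔼} (hφ : ContDiff ℝ ∞ φ) (hc : HasCompactSupport φ) (x : 𝔼) :
    Integrable (fun z : 𝔼 => inner ℝ z (φ (x + z) - φ x) / ‖z‖ ^ ((n : ℝ) + α + 1)) := by
  obtain ⟨C, hC, h, -⟩ := exists_incrementGauge_le hn hα hφ hc
  refine ⟨((measurable_divIntegrand hφ.continuous α).comp
    measurable_prodMk_left).aestronglyMeasurable, ?_⟩
  exact ((lintegral_mono fun z => enorm_inner_div_le α z _).trans (h x)).trans_lt hC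

theorem enorm_fracDiv_le (α : ℝ) (φ : 𝔼 → 𝔼) (x : 𝔼) :
    ‖fracDiv α φ x‖ₑ ≤ ‖fracConst n α‖ₑ * incrementGauge α φ x := by
  rw [fracDiv_eq, enorm_mul]
  gcongr
  exact (enorm_integral_le_lintegral_enorm _).trans
    (lintegral_mono fun z => enorm_inner_div_le α z _)

/-- Pairing with the fractional divergence of a test field is continuous on `L^p`. -/
theorem exists_lintegral_mul_fracDiv_le (hn : 1 ≤ n) {α : ℝ} (hα : α ∈ Set.Ioo (0 : ℝ) 1)
    {p : ℝ} (hp : 1 ≤ p) {φ : 𝔼 → 𝔼} (hφ : ContDiff ℝ ∞ φ) (hc : HasCompactSupport φ) :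
    ∃ C : ℝ≥0∞, C < ⊤ ∧ ∀ f : 𝔼 → ℝ, AEStronglyMeasurable f →
      ∫⁻ x, ‖f x * fracDiv α φ x‖ₑ ≤ C * eLpNorm f (ENNReal.ofReal p) volume := by
  obtain ⟨C, hC, h1, h2⟩ := exists_incrementGauge_le hn hα hφ hc
  have hp1 : 1 / p ≤ 1 := by rw [div_le_one (by linarith)]; exact hp
  have hp2 : 0 ≤ 1 / p := by positivity
  refine ⟨‖fracConst n α‖ₑ * (C ^ (1 / p) * C ^ (1 - 1 / p)), ?_, fun f hf => ?_⟩
  · exact ENNReal.mul_lt_top enorm_lt_top (ENNReal.mul_lt_top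
      (ENNReal.rpow_lt_top_of_nonneg hp2 hC.ne)
      (ENNReal.rpow_lt_top_of_nonneg (by linarith) hC.ne))
  have hG := measurable_incrementGauge hφ.continuous α
  calc ∫⁻ x, ‖f x * fracDiv α φ x‖ₑ
      ≤ ∫⁻ x, ‖fracConst n α‖ₑ * (‖f x‖ₑ * incrementGauge α φ x) := by
        refine lintegral_mono fun x => ?_
        rw [enorm_mul, mul_left_comm]
        gcongr
        exact enorm_fracDiv_le α φ x
    _ = ‖fracConst n α‖ₑ * ∫⁻ x, ‖f x‖ₑ * incrementGauge α φ x :=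
        lintegral_const_mul' _ _ enorm_ne_top
    _ ≤ ‖fracConst n α‖ₑ * (C ^ (1 / p) * eLpNorm f (ENNReal.ofReal p) volume *
          C ^ (1 - 1 / p)) := by
        gcongr
        refine (lintegral_enorm_mul_le hf hG h1 hp).trans ?_
        gcongr
    _ = _ := by ring

theorem integrable_mul_fracDiv (hn : 1 ≤ n) {α : ℝ} (hα : α ∈ Set.Ioo (0 : ℝ) 1)
    {p : ℝ} (hp : 1 ≤ p) {φ : 𝔼 → 𝔼} (hφ : ContDiff ℝ ∞ φ) (hc : HasCompactSupport φ)
    {f : 𝔼 → ℝ} (hf : MemLp f (ENNReal.ofReal p) volume) :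
    Integrable (fun x => f x * fracDiv α φ x) := by
  obtain ⟨C, hC, h⟩ := exists_lintegral_mul_fracDiv_le hn hα hp hφ hc
  exact ⟨hf.1.mul (measurable_fracDiv hφ.continuous α).aestronglyMeasurable,
    (h f hf.1).trans_lt (ENNReal.mul_lt_top hC hf.2)⟩

theorem tendsto_integral_mul_fracDiv (hn : 1 ≤ n) {α : ℝ} (hα : α ∈ Set.Ioo (0 : ℝ) 1)
    {p : ℝ} (hp : 1 ≤ p) {φ : 𝔼 → 𝔼} (hφ : ContDiff ℝ ∞ φ) (hc : HasCompactSupport φ)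
    {f : 𝔼 → ℝ} (hf : MemLp f (ENNReal.ofReal p) volume) {g : ℕ → 𝔼 → ℝ}
    (hg : ∀ k, MemLp (g k) (ENNReal.ofReal p) volume)
    (h : Tendsto (fun k => eLpNorm (g k - f) (ENNReal.ofReal p) volume) atTop (𝓝 0)) :
    Tendsto (fun k => ∫ x, g k x * fracDiv α φ x) atTop (𝓝 (∫ x, f x * fracDiv α φ x)) := by
  obtain ⟨C, hC, hb⟩ := exists_lintegral_mul_fracDiv_le hn hα hp hφ hc
  rw [tendsto_iff_edist_tendsto_0]
  have h0 := ENNReal.Tendsto.const_mul h (Or.inr hC.ne)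
  rw [mul_zero] at h0
  refine tendsto_of_tendsto_of_tendsto_of_le_of_le tendsto_const_nhds h0 (fun _ => zero_le)
    fun k => ?_
  dsimp only
  rw [edist_eq_enorm_sub, ← integral_sub (integrable_mul_fracDiv hn hα hp hφ hc (hg k))
    (integrable_mul_fracDiv hn hα hp hφ hc hf)]
  refine (enorm_integral_le_lintegral_enorm _).trans
    (le_trans (le_of_eq ?_) (hb _ ((hg k).1.sub hf.1)))
  simp only [Pi.sub_apply, sub_mul]

theorem le_fracVariation {α : ℝ} {φ : 𝔼 → 𝔼} (hφ : ContDiff ℝ ∞ φ) (hc : HasCompactSupport φ)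
    (h1 : ∀ x, ‖φ x‖ ≤ 1) (f : 𝔼 → ℝ) :
    ENNReal.ofReal (∫ x, f x * fracDiv α φ x) ≤ fracVariation α f :=
  le_iSup_of_le φ (le_iSup_of_le hφ (le_iSup_of_le hc (le_iSup_of_le h1 le_rfl)))

theorem fracVariation_congr_ae {α : ℝ} {f g : 𝔼 → ℝ} (h : f =ᵐ[volume] g) :
    fracVariation α f = fracVariation α g := by
  unfold fracVariation
  have (φ : 𝔼 → 𝔼) : ∫ x, f x * fracDiv α φ x = ∫ x, g x * fracDiv α φ x :=
    integral_congr_ae (h.mono fun x hx => by simp only [hx])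
  simp only [this]

/-- Lower semicontinuity of the fractional variation under `L^p` convergence. -/
theorem eventually_lt_fracVariation (hn : 1 ≤ n) {α : ℝ} (hα : α ∈ Set.Ioo (0 : ℝ) 1)
    {p : ℝ} (hp : 1 ≤ p) {f : 𝔼 → ℝ} (hf : MemLp f (ENNReal.ofReal p) volume) {g : ℕ → 𝔼 → ℝ}
    (hg : ∀ k, MemLp (g k) (ENNReal.ofReal p) volume)
    (h : Tendsto (fun k => eLpNorm (g k - f) (ENNReal.ofReal p) volume) atTop (𝓝 0))
    {a : ℝ≥0∞} (ha : a < fracVariation α f) : ∀ᶠ k in atTop, a < fracVariation α (g k) := by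
  unfold fracVariation at ha
  simp only [lt_iSup_iff] at ha
  obtain ⟨φ, hφ, hc, h1, ha⟩ := ha
  have ht := ENNReal.tendsto_ofReal (tendsto_integral_mul_fracDiv hn hα hp hφ hc hf hg h)
  exact (ht.eventually_const_lt ha).mono fun k hk => hk.trans_le (le_fracVariation hφ hc h1 _)

/-- The Leibniz defect of the fractional divergence is controlled by the cut-off alone. -/
theorem enorm_mul_fracDiv_sub_le (hn : 1 ≤ n) {α : ℝ} (hα : α ∈ Set.Ioo (0 : ℝ) 1)
    {φ : 𝔼 → 𝔼} (hφ : ContDiff ℝ ∞ φ) (hc : HasCompactSupport φ) (h1 : ∀ x, ‖φ x‖ ≤ 1)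
    {η : 𝔼 → ℝ} (hη : ContDiff ℝ ∞ η) (x : 𝔼) :
    ‖η x * fracDiv α φ x - fracDiv α (fun y => η y • φ y) x‖ₑ ≤
      ‖fracConst n α‖ₑ * incrementGauge α η x := by
  have hηφ : ContDiff ℝ ∞ (fun y => η y • φ y) := hη.smul hφ
  have hcηφ : HasCompactSupport (fun y => η y • φ y) :=
    hc.mono fun y hy h => hy (by simp only [h, smul_zero])
  rw [fracDiv_eq, fracDiv_eq, mul_left_comm, ← mul_sub, ← integral_const_mul,
    ← integral_sub ((integrable_divIntegrand hn hα hφ hc x).const_mul _)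
      (integrable_divIntegrand hn hα hηφ hcηφ x), enorm_mul]
  gcongr
  refine (enorm_integral_le_lintegral_enorm _).trans (lintegral_mono fun z => ?_)
  -- The terms in `η(x)φ(x)` cancel, so only `φ(x+z)` survives, multiplied by an increment of `η`;
  -- no regularity of `φ` enters the bound.
  have : η x * (inner ℝ z (φ (x + z) - φ x) / ‖z‖ ^ ((n : ℝ) + α + 1)) -
      inner ℝ z (η (x + z) • φ (x + z) - η x • φ x) / ‖z‖ ^ ((n : ℝ) + α + 1) =
      inner ℝ z (-((η (x + z) - η x) • φ (x + z))) / ‖z‖ ^ ((n : ℝ) + α + 1) := by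
    simp only [inner_sub_right, inner_smul_right, inner_neg_right]
    ring
  rw [this]
  refine (enorm_inner_div_le α z _).trans ?_
  gcongr
  rw [enorm_neg, enorm_smul]
  refine mul_le_of_le_one_right zero_le ?_
  rw [← ofReal_norm]
  exact ENNReal.ofReal_le_one.2 (h1 _)

/-- Moving `η` onto the test field gives the competitor `ηφ` for `f`; the remainder is `f` paired
with the Leibniz defect. -/
theorem fracVariation_mul_le (hn : 1 ≤ n) {α : ℝ} (hα : α ∈ Set.Ioo (0 : ℝ) 1)
    {p : ℝ} (hp : 1 ≤ p) {f : 𝔼 → ℝ} (hf : MemLp f (ENNReal.ofReal p) volume)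
    {η : 𝔼 → ℝ} (hη : ContDiff ℝ ∞ η) (hη1 : ∀ x, ‖η x‖ ≤ 1) :
    fracVariation α (fun x => η x * f x) ≤
      fracVariation α f + ‖fracConst n α‖ₑ * ∫⁻ x, ‖f x‖ₑ * incrementGauge α η x := by
  unfold fracVariation
  simp only [iSup_le_iff]
  intro φ hφ hc h1
  change _ ≤ fracVariation α f + _
  have hηφ : ContDiff ℝ ∞ (fun y => η y • φ y) := hη.smul hφ
  have hcηφ : HasCompactSupport (fun y => η y • φ y) :=
    hc.mono fun y hy h => hy (by simp only [h, smul_zero])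
  have h1ηφ : ∀ x, ‖η x • φ x‖ ≤ 1 := fun x => by
    rw [norm_smul]
    exact mul_le_one₀ (hη1 x) (norm_nonneg _) (h1 x)
  have hi1 := integrable_mul_fracDiv hn hα hp hηφ hcηφ hf
  have hi2 : Integrable (fun x => η x * (f x * fracDiv α φ x)) :=
    (integrable_mul_fracDiv hn hα hp hφ hc hf).bdd_mul hη.continuous.aestronglyMeasurable
      (Eventually.of_forall hη1)
  have heq : ∫ x, η x * f x * fracDiv α φ x =
      (∫ x, f x * fracDiv α (fun y => η y • φ y) x) +
        ∫ x, (η x * (f x * fracDiv α φ x) - f x * fracDiv α (fun y => η y • φ y) x) := by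
    rw [integral_sub hi2 hi1, add_sub_cancel]
    simp only [mul_assoc]
  rw [heq]
  refine ENNReal.ofReal_add_le.trans (add_le_add (le_fracVariation hηφ hcηφ h1ηφ f) ?_)
  rw [← lintegral_const_mul' _ _ enorm_ne_top]
  refine (ENNReal.ofReal_le_ofReal (le_abs_self _)).trans ?_
  rw [← Real.norm_eq_abs, ofReal_norm]
  refine (enorm_integral_le_lintegral_enorm _).trans (lintegral_mono fun x => ?_)
  have : η x * (f x * fracDiv α φ x) - f x * fracDiv α (fun y => η y • φ y) x =
      f x * (η x * fracDiv α φ x - fracDiv α (fun y => η y • φ y) x) := by ring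
  rw [this, enorm_mul, mul_left_comm]
  gcongr
  exact enorm_mul_fracDiv_sub_le hn hα hφ hc h1 hη x

end Divergence

/-! ### Mollification in `L^p` and in variation -/

section Mollification

open ContinuousLinearMap Pointwise
open scoped Convolution

variable {n : ℕ}

local notation "𝔼" => EuclideanSpace ℝ (Fin n)

/-- The mollification of `h` by the normalized bump function `ρ`. -/
noncomputable def mollify (ρ : ContDiffBump (0 : 𝔼)) (h : 𝔼 → ℝ) : 𝔼 → ℝ :=
  ρ.normed volume ⋆[lsmul ℝ ℝ, volume] h

theorem mollify_apply (ρ : ContDiffBump (0 : 𝔼)) (h : 𝔼 → ℝ) (x : 𝔼) :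
    mollify ρ h x = ∫ t, ρ.normed volume t * h (x - t) := rfl

theorem contDiff_mollify (ρ : ContDiffBump (0 : 𝔼)) {h : 𝔼 → ℝ} (hh : LocallyIntegrable h) :
    ContDiff ℝ ∞ (mollify ρ h) :=
  ρ.hasCompactSupport_normed.contDiff_convolution_left _ ρ.contDiff_normed hh

theorem hasCompactSupport_mollify (ρ : ContDiffBump (0 : 𝔼)) {h : 𝔼 → ℝ}
    (hh : HasCompactSupport h) : HasCompactSupport (mollify ρ h) :=
  ρ.hasCompactSupport_normed.convolution _ hh

theorem fracDiv_comp_add (α : ℝ) (φ : 𝔼 → 𝔼) (t x : 𝔼) :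
    fracDiv α (fun y => φ (y + t)) x = fracDiv α φ (x + t) := by
  simp only [fracDiv_eq, add_right_comm]

/-- A translation of `h` can be moved onto `φ`, because the fractional divergence commutes with
translations and translated fields remain admissible. -/
theorem integral_translate_mul_fracDiv_le {α : ℝ} {φ : 𝔼 → 𝔼} (hφ : ContDiff ℝ ∞ φ)
    (hc : HasCompactSupport φ) (h1 : ∀ x, ‖φ x‖ ≤ 1) {h : 𝔼 → ℝ}
    (hV : fracVariation α h ≠ ⊤) (t : 𝔼) :
    ∫ x, h (x - t) * fracDiv α φ x ≤ (fracVariation α h).toReal := by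
  have h2 : ∫ x, h (x - t) * fracDiv α φ x = ∫ x, h x * fracDiv α (fun y => φ (y + t)) x := by
    rw [← integral_add_right_eq_self _ t]
    simp only [add_sub_cancel_right, fracDiv_comp_add]
  have hφt : ContDiff ℝ ∞ (fun y => φ (y + t)) := hφ.comp (contDiff_id.add contDiff_const)
  have hct : HasCompactSupport (fun y => φ (y + t)) := hc.comp_homeomorph (Homeomorph.addRight t)
  rw [h2]
  exact (ENNReal.ofReal_le_iff_le_toReal hV).1 (le_fracVariation hφt hct (fun x => h1 _) h)

/-- Mollification does not increase the fractional variation. -/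
theorem fracVariation_mollify_le (hn : 1 ≤ n) {α : ℝ} (hα : α ∈ Set.Ioo (0 : ℝ) 1)
    (ρ : ContDiffBump (0 : 𝔼)) {h : 𝔼 → ℝ} (hh : Integrable h) :
    fracVariation α (mollify ρ h) ≤ fracVariation α h := by
  rcases eq_or_ne (fracVariation α h) ⊤ with hV | hV
  · rw [hV]
    exact le_top
  conv_lhs => unfold fracVariation
  simp only [iSup_le_iff]
  intro φ hφ hc h1
  rw [ENNReal.ofReal_le_iff_le_toReal hV]
  obtain ⟨C, hC, hb, -⟩ := exists_incrementGauge_le hn hα hφ hc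
  have hbd : ∀ x, ‖fracDiv α φ x‖ ≤ (‖fracConst n α‖ₑ * C).toReal := fun x => by
    rw [← ENNReal.ofReal_le_iff_le_toReal (ENNReal.mul_lt_top enorm_lt_top hC).ne, ofReal_norm]
    exact (enorm_fracDiv_le α φ x).trans (by gcongr; exact hb x)
  -- `div^α φ` is bounded and `h` is integrable, so Fubini applies and the pairing becomes a
  -- `ρ`-average of pairings with translates of `h`.
  have hint : Integrable (fun q : 𝔼 × 𝔼 =>
      fracDiv α φ q.1 * (ρ.normed volume q.2 * h (q.1 - q.2))) (volume.prod volume) :=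
    Integrable.bdd_mul (ρ.integrable_normed.convolution_integrand (lsmul ℝ ℝ) hh)
      ((measurable_fracDiv hφ.continuous α).comp measurable_fst).aestronglyMeasurable
      (Eventually.of_forall fun q => hbd q.1)
  have heq : ∫ x, mollify ρ h x * fracDiv α φ x =
      ∫ t, ρ.normed volume t * ∫ x, h (x - t) * fracDiv α φ x := by
    simp only [mollify_apply, mul_comm _ (fracDiv α φ _), ← integral_const_mul]
    rw [integral_integral_swap hint]
    simp only [mul_left_comm]
  have hint2 : Integrable (fun t => ρ.normed volume t * ∫ x, h (x - t) * fracDiv α φ x) := by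
    refine hint.integral_prod_right.congr (Eventually.of_forall fun t => ?_)
    dsimp only
    rw [← integral_const_mul]
    congr 1
    ext x
    ring
  rw [heq]
  calc ∫ t, ρ.normed volume t * ∫ x, h (x - t) * fracDiv α φ x
      ≤ ∫ t, ρ.normed volume t * (fracVariation α h).toReal := by
        refine integral_mono hint2 (ρ.integrable_normed.mul_const _) fun t => ?_
        exact mul_le_mul_of_nonneg_left
          (integral_translate_mul_fracDiv_le hφ hc h1 hV t) (ρ.nonneg_normed t)
    _ = (fracVariation α h).toReal := by rw [integral_mul_const, ρ.integral_normed, one_mul]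

/-- Young's inequality for mollification, from Jensen's inequality and Tonelli's theorem. -/
theorem eLpNorm_mollify_le (ρ : ContDiffBump (0 : 𝔼)) {u : 𝔼 → ℝ} (hu : Measurable u) {p : ℝ}
    (hp : 1 ≤ p) :
    eLpNorm (mollify ρ u) (ENNReal.ofReal p) volume ≤ eLpNorm u (ENNReal.ofReal p) volume := by
  have hp0 : 0 < p := by linarith
  have hpe : ENNReal.ofReal p ≠ 0 := by simpa using hp0
  set G : 𝔼 → ℝ≥0∞ := fun t => ENNReal.ofReal (ρ.normed volume t) with hGdef
  have hG : Measurable G := ρ.continuous_normed.measurable.ennreal_ofReal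
  set ν : Measure 𝔼 := volume.withDensity G with hν
  have hν1 : ν Set.univ = 1 := by
    rw [hν, withDensity_apply _ MeasurableSet.univ, Measure.restrict_univ,
      ← ofReal_integral_eq_lintegral_ofReal ρ.integrable_normed
        (Eventually.of_forall ρ.nonneg_normed), ρ.integral_normed, ENNReal.ofReal_one]
  have : IsProbabilityMeasure ν := ⟨hν1⟩
  have hux : ∀ x, Measurable (fun t => u (x - t)) := fun x =>
    hu.comp (measurable_const.sub measurable_id)
  have hpt : ∀ x, ‖mollify ρ u x‖ₑ ^ p ≤ ∫⁻ t, ‖u (x - t)‖ₑ ^ p ∂ν := by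
    intro x
    have h1 : ‖mollify ρ u x‖ₑ ≤ eLpNorm (fun t => u (x - t)) 1 ν := by
      rw [eLpNorm_one_eq_lintegral_enorm, hν,
        lintegral_withDensity_eq_lintegral_mul _ hG (hux x).enorm, mollify_apply]
      refine (enorm_integral_le_lintegral_enorm _).trans (lintegral_mono fun t => ?_)
      rw [enorm_mul, Real.enorm_of_nonneg (ρ.nonneg_normed t)]
      exact le_rfl
    -- Jensen, as monotonicity of the `L^q` seminorms in `q` for the probability measure `ν`.
    have h2 := h1.trans (eLpNorm_le_eLpNorm_of_exponent_le (q := ENNReal.ofReal p)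
      (by simpa using hp) (hux x).aestronglyMeasurable)
    rw [eLpNorm_eq_lintegral_rpow_enorm_toReal hpe ENNReal.ofReal_ne_top,
      ENNReal.toReal_ofReal hp0.le] at h2
    refine (ENNReal.rpow_le_rpow h2 hp0.le).trans (le_of_eq ?_)
    rw [← ENNReal.rpow_mul, one_div_mul_cancel hp0.ne', ENNReal.rpow_one]
  rw [eLpNorm_eq_lintegral_rpow_enorm_toReal hpe ENNReal.ofReal_ne_top,
    eLpNorm_eq_lintegral_rpow_enorm_toReal hpe ENNReal.ofReal_ne_top,
    ENNReal.toReal_ofReal hp0.le]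
  refine ENNReal.rpow_le_rpow ((lintegral_mono hpt).trans (le_of_eq ?_)) (by positivity)
  rw [lintegral_lintegral_swap]
  · have : ∀ t : 𝔼, ∫⁻ x, ‖u (x - t)‖ₑ ^ p = ∫⁻ x, ‖u x‖ₑ ^ p := fun t =>
      lintegral_sub_right_eq_self (fun x => ‖u x‖ₑ ^ p) t
    simp only [this, lintegral_const, hν1, mul_one]
  · exact ((hu.comp (measurable_fst.sub measurable_snd)).enorm.pow_const p).aemeasurable

theorem exists_eLpNorm_mollify_sub_le_of_continuous {p : ℝ} {g : 𝔼 → ℝ}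
    (hg : Continuous g) (hc : HasCompactSupport g) {ε : ℝ≥0∞} (hε : ε ≠ 0) :
    ∃ ρ : ContDiffBump (0 : 𝔼),
      eLpNorm (mollify ρ g - g) (ENNReal.ofReal p) volume ≤ ε := by
  set S : Set 𝔼 := tsupport g + Metric.closedBall 0 1 with hS
  have hSc : IsCompact S := hc.isCompact.add (isCompact_closedBall 0 1)
  have hv : volume S ^ (1 / (ENNReal.ofReal p).toReal) ≠ ⊤ :=
    ENNReal.rpow_ne_top_of_nonneg (by positivity) hSc.measure_lt_top.ne
  obtain ⟨δ, hδ, hδε⟩ : ∃ δ : ℝ, 0 < δ ∧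
      ENNReal.ofReal δ * volume S ^ (1 / (ENNReal.ofReal p).toReal) ≤ ε := by
    have ht : Tendsto (fun δ : ℝ => ENNReal.ofReal δ *
        volume S ^ (1 / (ENNReal.ofReal p).toReal)) (𝓝[>] 0) (𝓝 0) := by
      have h0 : Tendsto (fun δ : ℝ => ENNReal.ofReal δ) (𝓝[>] 0) (𝓝 0) := by
        simpa using (ENNReal.continuous_ofReal.tendsto 0).mono_left nhdsWithin_le_nhds
      simpa using ENNReal.Tendsto.mul_const h0 (Or.inr hv)
    obtain ⟨δ, h1, h2⟩ :=
      ((ht.eventually_le_const (pos_iff_ne_zero.2 hε)).and self_mem_nhdsWithin).exists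
    exact ⟨δ, h2, h1⟩
  obtain ⟨r, hr, hgr⟩ := Metric.uniformContinuous_iff.1
    (hc.uniformContinuous_of_continuous hg) δ hδ
  -- Outer radius at most `r` gives oscillation at most `δ`; at most `1` keeps the support inside
  -- the fixed compact set `S`.
  let ρ : ContDiffBump (0 : 𝔼) :=
    ⟨min r 1 / 2, min r 1, by positivity, half_lt_self (by positivity)⟩
  have h0S : (0 : 𝔼) ∈ Metric.closedBall (0 : 𝔼) 1 := by simp
  refine ⟨ρ, (eLpNorm_sub_le_of_dist_bdd volume ENNReal.ofReal_ne_top hSc.measurableSet hδ.le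
    (fun x => ?_) ?_ ?_).trans hδε⟩
  · refine ContDiffBump.dist_normed_convolution_le hg.aestronglyMeasurable fun y hy => ?_
    exact (hgr ((Metric.mem_ball.1 hy).trans_le (min_le_left _ _))).le
  · refine (support_convolution_subset_swap (lsmul ℝ ℝ)).trans ?_
    refine Set.add_subset_add (subset_tsupport g) ?_
    rw [ρ.support_normed_eq (μ := volume)]
    exact (Metric.ball_subset_closedBall).trans
      (Metric.closedBall_subset_closedBall (min_le_right _ _))
  · intro x hx
    exact ⟨x, subset_tsupport g hx, 0, h0S, add_zero x⟩

/-- Mollifications approximate in `L^p`. -/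
theorem exists_eLpNorm_mollify_sub_le {p : ℝ} (hp : 1 ≤ p) {h : 𝔼 → ℝ} (hm : Measurable h)
    (hh : MemLp h (ENNReal.ofReal p) volume) {ε : ℝ≥0∞} (hε : ε ≠ 0) :
    ∃ ρ : ContDiffBump (0 : 𝔼),
      eLpNorm (mollify ρ h - h) (ENNReal.ofReal p) volume ≤ ε := by
  have hp1 : 1 ≤ ENNReal.ofReal p := by simpa using hp
  have hε3 : ε / 3 ≠ 0 := by simp [hε]
  obtain ⟨g, hgc, hhg, hg, hgp⟩ :=
    hh.exists_hasCompactSupport_eLpNorm_sub_le ENNReal.ofReal_ne_top hε3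
  obtain ⟨ρ, hρ⟩ := exists_eLpNorm_mollify_sub_le_of_continuous (p := p) hg hgc hε3
  refine ⟨ρ, ?_⟩
  have hhl := hh.locallyIntegrable hp1
  have hgl := hgp.locallyIntegrable hp1
  have hlin : mollify ρ (h - g) = mollify ρ h - mollify ρ g := by
    ext x
    have e1 := (ρ.hasCompactSupport_normed (μ := volume)).convolutionExists_left (lsmul ℝ ℝ) (μ := volume)
      ρ.continuous_normed hhl x
    have e2 := (ρ.hasCompactSupport_normed (μ := volume)).convolutionExists_left (lsmul ℝ ℝ) (μ := volume)
      ρ.continuous_normed hgl x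
    simp only [Pi.sub_apply, mollify_apply, mul_sub]
    exact integral_sub e1 e2
  -- Three-`ε` splitting: Young's inequality controls the first term by the last, and the middle one
  -- involves only the continuous `g`.
  have hdec : mollify ρ h - h = mollify ρ (h - g) + (mollify ρ g - g) - (h - g) := by
    rw [hlin]
    abel
  have c1 := (contDiff_mollify ρ hhl).continuous.aestronglyMeasurable (μ := volume)
  have c2 := (contDiff_mollify ρ hgl).continuous.aestronglyMeasurable (μ := volume)
  have c3 := hg.aestronglyMeasurable (μ := volume)
  have c4 : AEStronglyMeasurable (mollify ρ (h - g)) volume := by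
    rw [hlin]
    exact c1.sub c2
  rw [hdec]
  calc _ ≤ eLpNorm (mollify ρ (h - g) + (mollify ρ g - g)) (ENNReal.ofReal p) volume +
        eLpNorm (h - g) (ENNReal.ofReal p) volume :=
        eLpNorm_sub_le (c4.add (c2.sub c3)) (hh.1.sub c3) hp1
    _ ≤ (ε / 3 + ε / 3) + ε / 3 := by
        refine add_le_add ((eLpNorm_add_le c4 (c2.sub c3) hp1).trans (add_le_add ?_ hρ)) hhg
        exact (eLpNorm_mollify_le ρ (hm.sub hg.measurable) hp).trans hhg
    _ = ε := ENNReal.add_thirds ε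

end Mollification

/-! ### Cut-off at scale `R` and construction of the sequence -/

section Cutoff

variable {n : ℕ}

local notation "𝔼" => EuclideanSpace ℝ (Fin n)

/-- The standard bump function, equal to `1` on the unit ball and supported in the ball of
radius `2`. -/
noncomputable def unitBump (n : ℕ) : ContDiffBump (0 : EuclideanSpace ℝ (Fin n)) :=
  ⟨1, 2, one_pos, one_lt_two⟩

/-- The cut-off function at scale `R`. -/
noncomputable def cutoff (n : ℕ) (R : ℝ) (x : EuclideanSpace ℝ (Fin n)) : ℝ :=
  unitBump n (R⁻¹ • x)

theorem contDiff_cutoff (R : ℝ) : ContDiff ℝ ∞ (cutoff n R) :=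
  (unitBump n).contDiff.comp (contDiff_const_smul R⁻¹)

theorem norm_cutoff_le (R : ℝ) (x : 𝔼) : ‖cutoff n R x‖ ≤ 1 := by
  rw [cutoff, Real.norm_of_nonneg (unitBump n).nonneg]
  exact (unitBump n).le_one

theorem norm_one_sub_cutoff_le (R : ℝ) (x : 𝔼) : ‖1 - cutoff n R x‖ ≤ 1 := by
  rw [cutoff, Real.norm_of_nonneg (sub_nonneg.2 (unitBump n).le_one)]
  linarith [(unitBump n).nonneg (x := R⁻¹ • x)]

theorem cutoff_eq_one {R : ℝ} (hR : 0 < R) {x : 𝔼} (hx : ‖x‖ ≤ R) : cutoff n R x = 1 := by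
  refine (unitBump n).one_of_mem_closedBall ?_
  rw [mem_closedBall_zero_iff, norm_smul, norm_inv, Real.norm_of_nonneg hR.le]
  change R⁻¹ * ‖x‖ ≤ 1
  rw [inv_mul_le_iff₀ hR]
  linarith

theorem cutoff_eq_zero {R : ℝ} (hR : 0 < R) {x : 𝔼} (hx : x ∉ Metric.closedBall (0 : 𝔼) (2 * R)) :
    cutoff n R x = 0 := by
  refine (unitBump n).zero_of_le_dist ?_
  rw [mem_closedBall_zero_iff, not_le] at hx
  rw [dist_zero_right, norm_smul, norm_inv, Real.norm_of_nonneg hR.le]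
  change 2 ≤ R⁻¹ * ‖x‖
  rw [le_inv_mul_iff₀ hR]
  linarith

theorem hasCompactSupport_cutoff {R : ℝ} (hR : 0 < R) : HasCompactSupport (cutoff n R) :=
  HasCompactSupport.intro (isCompact_closedBall 0 (2 * R)) fun _ hx => cutoff_eq_zero hR hx

/-- All cut-offs are dilates of one bump, so `A` is independent of `R` and only the slope scales. -/
theorem exists_hasTruncatedModulus_cutoff (n : ℕ) : ∃ A : ℝ, 0 ≤ A ∧ ∀ R : ℝ, 0 < R →
    HasTruncatedModulus (cutoff n R) A R⁻¹ := by
  obtain ⟨A, hA, h⟩ := exists_hasTruncatedModulus (unitBump n).contDiff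
    (unitBump n).hasCompactSupport
  refine ⟨A, hA, fun R hR x z => ?_⟩
  have := h (R⁻¹ • x) (R⁻¹ • z)
  rwa [← smul_add, one_mul, norm_smul, norm_inv, Real.norm_of_nonneg hR.le] at this

theorem cutoff_exponent_neg {N α p : ℝ} (hN : α < N) (hp : p ∈ Set.Ico (1 : ℝ) (N / (N - α))) :
    (-α) * (1 / p) + (N - α) * (1 - 1 / p) < 0 := by
  have hp0 : 0 < p := by linarith [hp.1]
  have h1 : p * (N - α) < N := (lt_div_iff₀ (by linarith)).1 hp.2
  have h2 : (-α) * (1 / p) + (N - α) * (1 - 1 / p) = (p * (N - α) - N) / p := by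
    field_simp
    ring
  rw [h2]
  exact div_neg_of_neg_of_pos (by linarith) hp0

/-- The Leibniz defect of the cut-off at scale `R` vanishes as `R → ∞`; this is where
`p < n / (n - α)` is used. -/
theorem tendsto_lintegral_incrementGauge_cutoff (hn : 1 ≤ n) {α : ℝ} (hα : α ∈ Set.Ioo (0 : ℝ) 1)
    {p : ℝ} (hp : p ∈ Set.Ico (1 : ℝ) ((n : ℝ) / ((n : ℝ) - α)))
    {f : 𝔼 → ℝ} (hf : MemLp f (ENNReal.ofReal p) volume) :
    Tendsto (fun R : ℝ => ∫⁻ x, ‖f x‖ₑ * incrementGauge α (cutoff n R) x) atTop (𝓝 0) := by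
  obtain ⟨A, hA, hmod⟩ := exists_hasTruncatedModulus_cutoff n
  have hW := truncMass_lt_top hn hα
  have hp1 : 1 / p ≤ 1 := by rw [div_le_one (by linarith [hp.1])]; exact hp.1
  have hp0 : 0 ≤ 1 / p := by have := hp.1; positivity
  set D : ℝ≥0∞ := ENNReal.ofReal A * truncMass n α with hD
  have hDt : D < ⊤ := ENNReal.mul_lt_top ENNReal.ofReal_lt_top hW
  -- The ball of radius `2R` carrying the cut-off has volume `2^n |B_1| R^n`; `v` collects the
  -- factors independent of `R`.
  set v : ℝ≥0∞ := 2 * (ENNReal.ofReal (2 ^ n) * volume (Metric.ball (0 : 𝔼) 1)) * D with hv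
  have hvt : v < ⊤ := ENNReal.mul_lt_top (ENNReal.mul_lt_top (by simp)
    (ENNReal.mul_lt_top ENNReal.ofReal_lt_top measure_ball_lt_top)) hDt
  set K : ℝ≥0∞ := D ^ (1 / p) * eLpNorm f (ENNReal.ofReal p) volume * v ^ (1 - 1 / p) with hK
  have hKt : K ≠ ⊤ := (ENNReal.mul_lt_top (ENNReal.mul_lt_top
    (ENNReal.rpow_lt_top_of_nonneg hp0 hDt.ne) hf.2)
    (ENNReal.rpow_lt_top_of_nonneg (by linarith) hvt.ne)).ne
  set e : ℝ := (-α) * (1 / p) + ((n : ℝ) - α) * (1 - 1 / p) with he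
  have hn' : (1 : ℝ) ≤ n := by exact_mod_cast hn
  have he0 : e < 0 := cutoff_exponent_neg (by linarith [hα.2]) hp
  have hbound : ∀ R : ℝ, 0 < R →
      ∫⁻ x, ‖f x‖ₑ * incrementGauge α (cutoff n R) x ≤ K * ENNReal.ofReal (R ^ e) := by
    intro R hR
    have hR' : 0 < R⁻¹ := inv_pos.2 hR
    have hRα : R⁻¹ ^ α = R ^ (-α) := by rw [Real.inv_rpow hR.le, Real.rpow_neg hR.le]
    have hcont := (contDiff_cutoff (n := n) R).continuous
    have h1 : ∀ x, incrementGauge α (cutoff n R) x ≤ D * ENNReal.ofReal (R ^ (-α)) := fun x => by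
      refine (incrementGauge_le hA hR' (hmod R hR) x).trans (le_of_eq ?_)
      rw [hRα, hD]
      ring
    have h2 : ∫⁻ x, incrementGauge α (cutoff n R) x ≤ v * ENNReal.ofReal (R ^ ((n : ℝ) - α)) := by
      refine (lintegral_incrementGauge_le hA hR' hcont (hmod R hR)
        Metric.isClosed_closedBall.measurableSet
        (fun x hx => cutoff_eq_zero hR hx)).trans (le_of_eq ?_)
      rw [Measure.addHaar_closedBall _ _ (by positivity), finrank_euclideanSpace_fin, hRα, mul_pow,
        ENNReal.ofReal_mul (by positivity), sub_eq_add_neg, Real.rpow_add hR,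
        ENNReal.ofReal_mul (by positivity), Real.rpow_natCast, hv, hD]
      ring
    refine (lintegral_enorm_mul_le hf.1 (measurable_incrementGauge hcont α) h1 hp.1).trans ?_
    calc _ ≤ (D * ENNReal.ofReal (R ^ (-α))) ^ (1 / p) * eLpNorm f (ENNReal.ofReal p) volume *
          (v * ENNReal.ofReal (R ^ ((n : ℝ) - α))) ^ (1 - 1 / p) := by
          gcongr
      _ = K * (ENNReal.ofReal (R ^ (-α)) ^ (1 / p) *
            ENNReal.ofReal (R ^ ((n : ℝ) - α)) ^ (1 - 1 / p)) := by
          rw [ENNReal.mul_rpow_of_nonneg D _ hp0, ENNReal.mul_rpow_of_nonneg v _ (by linarith), hK]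
          ring
      _ = K * ENNReal.ofReal (R ^ e) := by
          rw [ENNReal.ofReal_rpow_of_pos (by positivity), ENNReal.ofReal_rpow_of_pos (by positivity),
            ← ENNReal.ofReal_mul (by positivity), ← Real.rpow_mul hR.le, ← Real.rpow_mul hR.le,
            ← Real.rpow_add hR]
  have hlim : Tendsto (fun R : ℝ => K * ENNReal.ofReal (R ^ e)) atTop (𝓝 0) := by
    have h1 : Tendsto (fun R : ℝ => R ^ e) atTop (𝓝 0) := by
      simpa using tendsto_rpow_neg_atTop (neg_pos.2 he0)
    have h2 := ENNReal.Tendsto.const_mul (ENNReal.tendsto_ofReal h1) (Or.inr hKt)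
    simpa using h2
  exact tendsto_of_tendsto_of_tendsto_of_le_of_le' tendsto_const_nhds hlim
    (Eventually.of_forall fun _ => zero_le) ((eventually_gt_atTop 0).mono hbound)

/-- Approximate `f` by a compactly supported `g`. Once the cut-off is `1` on the support of `g`, the
error is `-(1 - η_R)(f - g)`, at most `|f - g|` in norm. -/
theorem eventually_eLpNorm_cutoff_mul_sub_le {p : ℝ} {f : 𝔼 → ℝ}
    (hf : MemLp f (ENNReal.ofReal p) volume) {ε : ℝ≥0∞} (hε : ε ≠ 0) :
    ∀ᶠ R : ℝ in atTop,
      eLpNorm ((fun x => cutoff n R x * f x) - f) (ENNReal.ofReal p) volume ≤ ε := by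
  obtain ⟨g, hgc, hfg, -, -⟩ :=
    hf.exists_hasCompactSupport_eLpNorm_sub_le ENNReal.ofReal_ne_top hε
  obtain ⟨r, hr⟩ := hgc.isCompact.isBounded.subset_closedBall 0
  filter_upwards [eventually_gt_atTop 0, eventually_ge_atTop r] with R hR0 hRr
  refine le_trans (eLpNorm_mono fun x => ?_) hfg
  have hg : (1 - cutoff n R x) * g x = 0 := by
    by_cases hx : g x = 0
    · rw [hx, mul_zero]
    · have := mem_closedBall_zero_iff.1 (hr (subset_tsupport g hx))
      rw [cutoff_eq_one hR0 (this.trans hRr), sub_self, zero_mul]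
  have : ((fun x => cutoff n R x * f x) - f) x = -((1 - cutoff n R x) * (f - g) x) := by
    simp only [Pi.sub_apply, mul_sub, hg]
    ring
  rw [this, norm_neg, norm_mul]
  exact mul_le_of_le_one_left (norm_nonneg _) (norm_one_sub_cutoff_le R x)

/-- Smooth compactly supported functions approximate in `L^p` with almost no larger variation. -/
theorem exists_contDiff_approx (hn : 1 ≤ n) {α : ℝ} (hα : α ∈ Set.Ioo (0 : ℝ) 1)
    {p : ℝ} (hp : p ∈ Set.Ico (1 : ℝ) ((n : ℝ) / ((n : ℝ) - α)))
    {f : 𝔼 → ℝ} (hm : Measurable f) (hf : MemLp f (ENNReal.ofReal p) volume)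
    {ε : ℝ≥0∞} (hε : ε ≠ 0) :
    ∃ g : 𝔼 → ℝ, ContDiff ℝ ∞ g ∧ HasCompactSupport g ∧
      eLpNorm (g - f) (ENNReal.ofReal p) volume ≤ ε ∧
      fracVariation α g ≤ fracVariation α f + ε := by
  have hp1 : 1 ≤ ENNReal.ofReal p := by simpa using hp.1
  have hε2 : ε / 2 ≠ 0 := by simp [hε]
  have hlim := ENNReal.Tendsto.const_mul (a := ‖fracConst n α‖ₑ)
    (tendsto_lintegral_incrementGauge_cutoff hn hα hp hf) (Or.inr enorm_ne_top)
  rw [mul_zero] at hlim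
  obtain ⟨R, hR0, hR1, hR2⟩ := ((eventually_gt_atTop (0 : ℝ)).and
    ((eventually_eLpNorm_cutoff_mul_sub_le hf hε2).and
      (hlim.eventually_le_const (pos_iff_ne_zero.2 hε)))).exists
  set h : 𝔼 → ℝ := fun x => cutoff n R x * f x with hh
  have hcont := (contDiff_cutoff (n := n) R).continuous
  have hhm : Measurable h := hcont.measurable.mul hm
  have hhp : MemLp h (ENNReal.ofReal p) volume := by
    refine hf.of_le hhm.aestronglyMeasurable (Eventually.of_forall fun x => ?_)
    rw [hh, norm_mul]
    exact mul_le_of_le_one_left (norm_nonneg _) (norm_cutoff_le R x)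
  have hhc : HasCompactSupport h := by
    refine (hasCompactSupport_cutoff (n := n) hR0).mono fun x hx h0 => hx ?_
    simp only [hh, h0, zero_mul]
  -- This is why the cut-off precedes mollification: compact support turns local integrability into
  -- the integrability needed for Fubini.
  have hhi : Integrable h :=
    (hf.locallyIntegrable hp1).integrable_smul_left_of_hasCompactSupport hcont
      (hasCompactSupport_cutoff hR0)
  obtain ⟨ρ, hρ⟩ := exists_eLpNorm_mollify_sub_le hp.1 hhm hhp hε2
  have hsm := contDiff_mollify ρ hhi.locallyIntegrable
  refine ⟨mollify ρ h, hsm, hasCompactSupport_mollify ρ hhc, ?_, ?_⟩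
  · rw [← sub_add_sub_cancel (mollify ρ h) h f, ← ENNReal.add_halves ε]
    exact (eLpNorm_add_le (hsm.continuous.aestronglyMeasurable.sub hhp.1) (hhp.1.sub hf.1)
      hp1).trans (add_le_add hρ hR1)
  · refine (fracVariation_mollify_le hn hα ρ hhi).trans ?_
    refine (fracVariation_mul_le hn hα hp.1 hf (contDiff_cutoff R) (norm_cutoff_le R)).trans ?_
    gcongr

theorem exists_seq_tendsto_fracVariation (hn : 1 ≤ n) {α : ℝ} (hα : α ∈ Set.Ioo (0 : ℝ) 1)
    {p : ℝ} (hp : p ∈ Set.Ico (1 : ℝ) ((n : ℝ) / ((n : ℝ) - α)))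
    {f : 𝔼 → ℝ} (hm : Measurable f) (hf : MemLp f (ENNReal.ofReal p) volume) :
    ∃ g : ℕ → 𝔼 → ℝ,
      (∀ k, ContDiff ℝ ∞ (g k) ∧ HasCompactSupport (g k)) ∧
      Tendsto (fun k => eLpNorm (g k - f) (ENNReal.ofReal p) volume) atTop (𝓝 0) ∧
      Tendsto (fun k => fracVariation α (g k)) atTop (𝓝 (fracVariation α f)) := by
  -- Tolerance `1/k`; at `k = 0` it is `⊤`, which is harmless.
  have h0 : ∀ k : ℕ, ((k : ℝ≥0∞))⁻¹ ≠ 0 := fun k => ENNReal.inv_ne_zero.2 (ENNReal.natCast_ne_top k)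
  choose g hg1 hg2 hg3 hg4 using fun k : ℕ => exists_contDiff_approx hn hα hp hm hf (h0 k)
  have hlim : Tendsto (fun k => eLpNorm (g k - f) (ENNReal.ofReal p) volume) atTop (𝓝 0) :=
    tendsto_of_tendsto_of_tendsto_of_le_of_le tendsto_const_nhds
      ENNReal.tendsto_inv_nat_nhds_zero (fun _ => zero_le) hg3
  refine ⟨g, fun k => ⟨hg1 k, hg2 k⟩, hlim, tendsto_order.2 ⟨fun a ha => ?_, fun b hb => ?_⟩⟩
  · exact eventually_lt_fracVariation hn hα hp.1 hf
      (fun k => (hg1 k).continuous.memLp_of_hasCompactSupport (hg2 k)) hlim ha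
  · have hu : Tendsto (fun k : ℕ => fracVariation α f + ((k : ℝ≥0∞))⁻¹) atTop
        (𝓝 (fracVariation α f)) := by
      simpa using tendsto_const_nhds.add ENNReal.tendsto_inv_nat_nhds_zero
    exact (hu.eventually_lt_const hb).mono fun k hk => (hg4 k).trans_lt hk

end Cutoff

end FractionalVariation

theorem mainTheorem5 (n : ℕ) (hn : 1 ≤ n) (α : ℝ) (hα : α ∈ Set.Ioo (0 : ℝ) 1)
    (p : ℝ) (hp : p ∈ Set.Ico (1 : ℝ) ((n : ℝ) / ((n : ℝ) - α)))
    (f : EuclideanSpace ℝ (Fin n) → ℝ)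
    (hf : FractionalVariation.MemBV α (ENNReal.ofReal p) f) :
    ∃ g : ℕ → EuclideanSpace ℝ (Fin n) → ℝ,
      (∀ k, ContDiff ℝ ∞ (g k) ∧ HasCompactSupport (g k)) ∧
      Tendsto (fun k => eLpNorm (g k - f) (ENNReal.ofReal p) volume) atTop (𝓝 0) ∧
      Tendsto (fun k => FractionalVariation.fracVariation α (g k)) atTop
        (𝓝 (FractionalVariation.fracVariation α f)) := by
  -- Pass to a Borel representative, as the mollification bounds assume measurability; variation and
  -- `L^p` distance see only the almost everywhere class.
  have hae := hf.1.1.ae_eq_mk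
  obtain ⟨g, hg1, hg2, hg3⟩ := FractionalVariation.exists_seq_tendsto_fracVariation hn hα hp
    hf.1.1.stronglyMeasurable_mk.measurable (hf.1.ae_eq hae)
  refine ⟨g, hg1, ?_, ?_⟩
  · refine hg2.congr fun k => eLpNorm_congr_ae ?_
    exact hae.symm.mono fun x hx => by simp only [Pi.sub_apply, hx]
  · rwa [FractionalVariation.fracVariation_congr_ae hae]
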